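/- Let $\mathbb{P}$ be the set of positive integers with the usual order and let $\mathbb{P}^*$ be the set of finite words over $\mathbb{P}$ (including the empty word). For $u,w\in\mathbb{P}^*$ write $u\le w$ if $w$ has a factor (block of consecutive letters) $v$ of length $|u|$ such that the $i$-th letter of $v$ is at least the $i$-th letter of $u$ for every $i$. For $w\in\mathbb{P}^*$ let $|w|$ be its length, let $\Sigma(w)$ be the sum of its letters, and let $\mathrm{wt}(w)=t^{|w|}x^{\Sigma(w)}$. For $u\in\mathbb{P}^*$ let $F(u;t,x)=\sum_{w\in\mathbb{P}^*,\,u\le w}\mathrm{wt}(w)$, a formal power series in $t$ and $x$. Words $u,v$ are called Wilf equivalent if $F(u;t,x)=F(v;t,x)$. A word $u$ has an increasing/decreasing factorization if $u=u_{inc}\,u_{dec}$, where $u_{inc}$ is the longest weakly increasing prefix of $u$ and the remaining word $u_{dec}$ is weakly decreasing (possibly empty). Theorem. If $u,v\in\mathbb{P}^*$ both have increasing/decreasing factorizations, then $u$ and $v$ are Wilf equivalent if and only if $u$ is a rearrangement of $v$ (that is, the two words have the same letters with the same multiplicities). -/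

import Mathlib

namespace FactorOrder

/-- Generalized factor order on words over a poset `α`: some factor (block of consecutive letters)
`v` of `w`, of the same length as `u`, is letter by letter at least `u`. -/
def Embeds {α : Type*} [PartialOrder α] (u w : List α) : Prop :=
  ∃ v : List α, v <:+: w ∧ List.Forall₂ (· ≤ ·) u v

/-- The sum `Σ(w)` of the letters of a word over the positive integers. -/
def letterSum (w : List ℕ+) : ℕ := (w.map (fun a : ℕ+ => (a : ℕ))).sum

/-- The formal variable `t`, which marks the length. -/
noncomputable def varT : MvPowerSeries (Fin 2) ℤ := MvPowerSeries.X 0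

/-- The formal variable `x`, which marks the sum of the letters. -/
noncomputable def varX : MvPowerSeries (Fin 2) ℤ := MvPowerSeries.X 1

/-- The weight `wt(w) = t ^ |w| * x ^ Σ(w)` of a word. -/
noncomputable def wt (w : List ℕ+) : MvPowerSeries (Fin 2) ℤ :=
  varT ^ w.length * varX ^ letterSum w

/-- `𝓕(u)`: the set of all words over the positive integers that embed `u`. -/
def wordsAbove (u : List ℕ+) : Set (List ℕ+) := {w | Embeds u w}

/-- The weight generating function `F(u; t, x) = ∑ wt(w)`, the sum over all words `w` that
embed `u`, as a formal power series: the coefficient of `t ^ n * x ^ m` is the number of such words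
of length `n` with letter sum `m`. See `hasSum_genF` for the identification with the sum. -/
noncomputable def genF (u : List ℕ+) : MvPowerSeries (Fin 2) ℤ :=
  fun d => (({w | w ∈ wordsAbove u ∧ w.length = d 0 ∧ letterSum w = d 1} : Set (List ℕ+)).ncard : ℤ)

/-- Wilf equivalence: equal weight generating functions. -/
def WilfEquiv (u v : List ℕ+) : Prop := genF u = genF v

/-- `p` is the longest weakly increasing prefix of `u`. -/
def IsLongestIncPrefix (p u : List ℕ+) : Prop :=
  p <+: u ∧ p.Pairwise (· ≤ ·) ∧
    ∀ p' : List ℕ+, p' <+: u → p'.Pairwise (· ≤ ·) → p'.length ≤ p.length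

/-- `u` has an increasing/decreasing factorization: what remains of `u` after its longest weakly
increasing prefix is weakly decreasing (possibly empty). -/
def HasIncDecFactorization (u : List ℕ+) : Prop :=
  ∃ p q : List ℕ+, IsLongestIncPrefix p u ∧ u = p ++ q ∧ q.Pairwise (· ≥ ·)

/-- Only finitely many words have a given length and letter sum. -/
theorem finite_words (n m : ℕ) : {w : List ℕ+ | w.length = n ∧ letterSum w = m}.Finite := by
  have hfin : {l : List (Fin (m + 1)) | l.length = n}.Finite := List.finite_length_eq _ n
  refine Set.Finite.of_finite_image (f := fun w : List ℕ+ => w.map (fun a : ℕ+ =>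
    (a : ℕ))) ((hfin.image (fun l => l.map Fin.val)).subset ?_) ?_
  · rintro _ ⟨w, ⟨hw, hs⟩, rfl⟩
    have hle : ∀ a ∈ w, (a : ℕ) < m + 1 := by
      intro a ha
      have := List.single_le_sum (l := w.map (fun a : ℕ+ => (a : ℕ))) (by simp) (a : ℕ)
        (List.mem_map.2 ⟨a, ha, rfl⟩)
      have h2 : (w.map (fun a : ℕ+ => (a : ℕ))).sum = m := hs
      omega
    refine ⟨w.pmap (fun (a : ℕ+) (h : (a : ℕ) < m + 1) => (⟨(a : ℕ), h⟩ : Fin (m + 1))) hle, by simpa using hw, ?_⟩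
    simp [List.map_pmap]
  · exact (List.map_injective_iff.2 PNat.coe_injective).injOn

theorem coeff_wt (w : List ℕ+) (d : Fin 2 →₀ ℕ) [Decidable (w.length = d 0 ∧ letterSum w = d 1)] :
    MvPowerSeries.coeff d (wt w) = if w.length = d 0 ∧ letterSum w = d 1 then 1 else 0 := by
  classical
  rw [wt, varT, varX, MvPowerSeries.X_pow_eq, MvPowerSeries.X_pow_eq,
    MvPowerSeries.monomial_mul_monomial, MvPowerSeries.coeff_monomial]
  have : d = Finsupp.single 0 w.length + Finsupp.single 1 (letterSum w) ↔
      (w.length = d 0 ∧ letterSum w = d 1) := by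
    rw [Finsupp.ext_iff, Fin.forall_fin_two]
    simp [eq_comm]
  simp [this]

open scoped MvPowerSeries.WithPiTopology in
/-- `F(u; t, x)` is the sum of the weights of the words that embed `u`. -/
theorem hasSum_genF (u : List ℕ+) : HasSum (fun w : wordsAbove u => wt w) (genF u) := by
  classical
  rw [MvPowerSeries.WithPiTopology.hasSum_iff_hasSum_coeff]
  intro d
  have hfin : {w : List ℕ+ | w ∈ wordsAbove u ∧ w.length = d 0 ∧ letterSum w = d 1}.Finite :=
    (finite_words (d 0) (d 1)).subset fun w hw => hw.2
  refine (hasSum_subtype_iff_indicator (f := fun w => MvPowerSeries.coeff d (wt w))).2 ?_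
  have key : MvPowerSeries.coeff d (genF u) = ∑ w ∈ hfin.toFinset,
      (wordsAbove u).indicator (fun w => MvPowerSeries.coeff d (wt w)) w := by
    rw [Finset.sum_congr rfl (g := fun _ => (1 : ℤ))]
    · rw [Finset.sum_const, nsmul_one, ← Set.ncard_eq_toFinset_card _ hfin]
      rfl
    · intro w hw
      rw [Set.Finite.mem_toFinset] at hw
      rw [Set.indicator_of_mem hw.1, coeff_wt, if_pos hw.2]
  rw [key]
  apply hasSum_sum_of_ne_finset_zero
  intro w hw
  rw [Set.Finite.mem_toFinset] at hw
  by_cases h : w ∈ wordsAbove u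
  · rw [Set.indicator_of_mem h, coeff_wt, if_neg fun h' => hw ⟨h, h'⟩]
  · exact Set.indicator_of_notMem h _

end FactorOrder

namespace FactorOrder

open Finset

/-! Fix the length `|u| + k` and apply inclusion-exclusion to the positions in `[0, k]` at which `u`
embeds (`ncard_wordsAbove`). The term of a set `S` depends only on `S` and the area of the least
word containing `u` at every position of `S`. If `u` has an increasing/decreasing factorization, its
level sets are intervals, so slicing by height turns this area into a sum over levels of sizes of
unions of translated intervals (`HasIncDecFactorization.envelopeArea_eq`). Only the interval
lengths, hence only the multiset of letters, matter; so rearrangements are Wilf equivalent.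

Conversely, these areas depend on `S` only through its consecutive gaps. By induction on `k`, the
terms other than that of `{0, k}` already agree (`sum_coverCard_congr`), so that term agrees too and
reveals its area. This yields the sums of `min k ℓ` over the level lengths `ℓ` for all `k`, which
determine the lengths (`eq_of_sum_min_eq`) and thus the letter counts. -/

/-! ### Coverings by translated intervals -/

/-- The number of integers covered by the translates `[s, s + ℓ)`, `s ∈ S`. -/
def coverCard (S : Finset ℕ) (ℓ : ℕ) : ℕ := #(S.biUnion fun s => Ico s (s + ℓ))

theorem coverCard_singleton (s ℓ : ℕ) : coverCard {s} ℓ = ℓ := by simp [coverCard]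

/-- The translate at `k` meets the others only inside the rightmost one, at `s`, so only the gap `k
- s` matters. -/
theorem coverCard_insert {S : Finset ℕ} {s k : ℕ} (hs : s ∈ S) (hmax : ∀ x ∈ S, x ≤ s)
    (hk : s ≤ k) (ℓ : ℕ) : coverCard (insert k S) ℓ = coverCard S ℓ + min (k - s) ℓ := by
  have hunion : ((insert k S).biUnion fun s => Ico s (s + ℓ)) =
      (S.biUnion fun s => Ico s (s + ℓ)) ∪ Ico (max k (s + ℓ)) (k + ℓ) := by
    ext x
    simp only [mem_biUnion, mem_insert, mem_union, mem_Ico]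
    constructor
    · rintro ⟨y, rfl | hy, h⟩
      · by_cases hx : x < s + ℓ
        · exact Or.inl ⟨s, hs, by omega⟩
        · exact Or.inr (by omega)
      · exact Or.inl ⟨y, hy, h⟩
    · rintro (⟨y, hy, h⟩ | h)
      · exact ⟨y, Or.inr hy, h⟩
      · exact ⟨k, Or.inl rfl, by omega⟩
  have hdisj : Disjoint (S.biUnion fun s => Ico s (s + ℓ)) (Ico (max k (s + ℓ)) (k + ℓ)) := by
    rw [Finset.disjoint_left]
    intro x hx hx'
    simp only [mem_biUnion, mem_Ico] at hx hx'
    obtain ⟨y, hy, h⟩ := hx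
    have := hmax y hy
    omega
  rw [coverCard, hunion, card_union_of_disjoint hdisj, Nat.card_Ico, coverCard]
  omega

theorem coverCard_pair (k ℓ : ℕ) : coverCard {0, k} ℓ = ℓ + min k ℓ := by
  rw [pair_comm, coverCard_insert (mem_singleton_self 0) (by simp) (Nat.zero_le k),
    coverCard_singleton, Nat.sub_zero]

theorem sum_coverCard_insert {S : Finset ℕ} {s k : ℕ} (hs : s ∈ S) (hmax : ∀ x ∈ S, x ≤ s)
    (hk : s ≤ k) (B : ℕ) (ℓ : ℕ → ℕ) :
    ∑ c ∈ range B, coverCard (insert k S) (ℓ c) =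
      ∑ c ∈ range B, coverCard S (ℓ c) + ∑ c ∈ range B, min (k - s) (ℓ c) := by
  rw [← sum_add_distrib]
  exact sum_congr rfl fun c _ => coverCard_insert hs hmax hk _

section Transfer

variable {B k : ℕ} {ℓ ℓ' : ℕ → ℕ}

theorem sum_coverCard_congr_of_subset_range
    (hmass : ∑ c ∈ range B, ℓ c = ∑ c ∈ range B, ℓ' c)
    (hgap : ∀ d < k, ∑ c ∈ range B, min d (ℓ c) = ∑ c ∈ range B, min d (ℓ' c))
    {S : Finset ℕ} (hne : S.Nonempty) (hS : S ⊆ range k) :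
    ∑ c ∈ range B, coverCard S (ℓ c) = ∑ c ∈ range B, coverCard S (ℓ' c) := by
  induction S using Finset.induction_on_max with
  | empty => simp at hne
  | insert a S ha ih =>
    rcases S.eq_empty_or_nonempty with rfl | hSne
    · simpa [coverCard_singleton] using hmass
    · have hmax : ∀ x ∈ S, x ≤ S.max' hSne := fun x hx => S.le_max' x hx
      have hmem := S.max'_mem hSne
      have hle := (ha _ hmem).le
      have hak : a < k := mem_range.1 (hS (mem_insert_self a S))
      rw [sum_coverCard_insert hmem hmax hle, sum_coverCard_insert hmem hmax hle,
        ih hSne ((subset_insert a S).trans hS), hgap _ (by omega)]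

/-- Once the total coverings of the sets `{0, d}` agree for all `d < k`, so do those of all nonempty
subsets of `[0, k]` other than `{0, k}`. -/
theorem sum_coverCard_congr
    (h : ∀ d < k, ∑ c ∈ range B, coverCard {0, d} (ℓ c) = ∑ c ∈ range B, coverCard {0, d} (ℓ' c))
    {S : Finset ℕ} (hne : S.Nonempty) (hS : S ⊆ range (k + 1)) (hpair : S ≠ {0, k}) :
    ∑ c ∈ range B, coverCard S (ℓ c) = ∑ c ∈ range B, coverCard S (ℓ' c) := by
  rcases Nat.eq_zero_or_pos k with rfl | hk
  · refine absurd ?_ hpair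
    rw [zero_add, range_one, hne.subset_singleton_iff] at hS
    simp [hS]
  have hmass : ∑ c ∈ range B, ℓ c = ∑ c ∈ range B, ℓ' c := by
    simpa [coverCard_singleton] using h 0 hk
  have hgap : ∀ d < k, ∑ c ∈ range B, min d (ℓ c) = ∑ c ∈ range B, min d (ℓ' c) := by
    intro d hd
    have := h d hd
    simp only [coverCard_pair, sum_add_distrib] at this
    omega
  by_cases hkS : k ∈ S
  · obtain ⟨T, hkT, rfl⟩ : ∃ T, k ∉ T ∧ S = insert k T :=
      ⟨S.erase k, notMem_erase k S, (insert_erase hkS).symm⟩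
    have hT : T ⊆ range k := by
      intro x hx
      have h1 := mem_range.1 (hS (mem_insert_of_mem hx))
      have h2 : x ≠ k := fun e => hkT (e ▸ hx)
      exact mem_range.2 (by omega)
    rcases T.eq_empty_or_nonempty with rfl | hTne
    · simpa [coverCard_singleton] using hmass
    · have hmax : ∀ x ∈ T, x ≤ T.max' hTne := fun x hx => T.le_max' x hx
      have hmem := T.max'_mem hTne
      have hlt := mem_range.1 (hT hmem)
      rw [sum_coverCard_insert hmem hmax hlt.le, sum_coverCard_insert hmem hmax hlt.le,
        sum_coverCard_congr_of_subset_range hmass hgap hTne hT]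
      congr 1
      -- The last gap equals `k` only when `T = {0}`, which is the excluded pair.
      rcases Nat.eq_zero_or_pos (T.max' hTne) with h0 | hpos
      · refine absurd ?_ hpair
        have : T = {0} := by
          rw [← hTne.subset_singleton_iff]
          intro x hx
          have := hmax x hx
          exact mem_singleton.2 (by omega)
        rw [this, pair_comm]
      · exact hgap _ (by omega)
  · refine sum_coverCard_congr_of_subset_range hmass hgap hne fun x hx => ?_
    have h1 := mem_range.1 (hS hx)
    have h2 : x ≠ k := fun e => hkS (e ▸ hx)
    exact mem_range.2 (by omega)

end Transfer

/-! ### Recovering a sequence from truncated sums -/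

theorem sum_min_succ (B d : ℕ) (ℓ : ℕ → ℕ) :
    ∑ c ∈ range B, min (d + 1) (ℓ c) = ∑ c ∈ range B, min d (ℓ c) + #{c ∈ range B | d < ℓ c} := by
  rw [card_filter, ← sum_add_distrib]
  refine sum_congr rfl fun c _ => ?_
  split_ifs <;> omega

/-- The indices with value above `d` form an initial segment. -/
theorem lt_iff_lt_card_of_antitone {ℓ : ℕ → ℕ} (hℓ : Antitone ℓ) {B c : ℕ} (hc : c < B) (d : ℕ) :
    d < ℓ c ↔ c < #{c ∈ range B | d < ℓ c} := by
  constructor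
  · intro h
    have : range (c + 1) ⊆ {c ∈ range B | d < ℓ c} := by
      intro x hx
      have hx' := mem_range.1 hx
      exact mem_filter.2 ⟨mem_range.2 (by omega), h.trans_le (hℓ (by omega))⟩
    simpa using card_le_card this
  · intro h
    by_contra hd
    have : ({c ∈ range B | d < ℓ c} : Finset ℕ) ⊆ range c := by
      intro x hx
      rw [mem_filter] at hx
      by_contra hxc
      exact hd (hx.2.trans_le (hℓ (by simpa using hxc)))
    have := card_le_card this
    rw [card_range] at this
    omega

/-- An antitone sequence is determined by its truncated sums. -/
theorem eq_of_sum_min_eq {ℓ ℓ' : ℕ → ℕ} (hℓ : Antitone ℓ) (hℓ' : Antitone ℓ') {B : ℕ}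
    (h : ∀ d, ∑ c ∈ range B, min d (ℓ c) = ∑ c ∈ range B, min d (ℓ' c)) {c : ℕ} (hc : c < B) :
    ℓ c = ℓ' c := by
  refine eq_of_forall_lt_iff fun d => ?_
  rw [lt_iff_lt_card_of_antitone hℓ hc, lt_iff_lt_card_of_antitone hℓ' hc]
  have h1 := h (d + 1)
  rw [sum_min_succ, sum_min_succ, h d] at h1
  rw [Nat.add_left_cancel h1]

/-! ### Slicing sums and counting tuples -/

theorem sum_eq_sum_card_lt (s : Finset ℕ) {f : ℕ → ℕ} {B : ℕ} (hf : ∀ j ∈ s, f j ≤ B) :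
    ∑ j ∈ s, f j = ∑ c ∈ range B, #{j ∈ s | c < f j} := by
  simp only [card_filter]
  rw [sum_comm]
  refine sum_congr rfl fun j hj => ?_
  rw [← card_filter]
  have : ({c ∈ range B | c < f j} : Finset ℕ) = range (f j) := by
    ext c
    have := hf j hj
    simp only [mem_filter, mem_range]
    omega
  rw [this, card_range]

open scoped Classical in
-- Subtracting `M` is a bijection, so the count sees `M` only through its total.
theorem card_piAntidiag_ge {N : ℕ} {M : ℕ → ℕ} (hM : ∀ j, M j ≠ 0 → j ∈ range N) (m : ℕ) :
    #{b ∈ piAntidiag (range N) m | M ≤ b} =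
      if ∑ j ∈ range N, M j ≤ m then #(piAntidiag (range N) (m - ∑ j ∈ range N, M j)) else 0 := by
  split_ifs with h
  · symm
    refine card_bij' (fun b _ => b + M) (fun b _ => b - M) ?_ ?_ ?_ ?_
    · intro b hb
      rw [mem_piAntidiag] at hb
      simp only [mem_filter, mem_piAntidiag, Pi.add_apply, sum_add_distrib]
      refine ⟨⟨by rw [hb.1, Nat.sub_add_cancel h], fun i hi => ?_⟩, fun i => by simp⟩
      by_cases hi' : M i = 0
      · exact hb.2 i (by omega)
      · exact hM i hi'
    · intro b hb
      simp only [mem_filter, mem_piAntidiag] at hb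
      simp only [mem_piAntidiag, Pi.sub_apply]
      refine ⟨?_, fun i hi => hb.1.2 i (by omega)⟩
      rw [sum_tsub_distrib _ fun i _ => hb.2 i, hb.1.1]
    · intro b _
      exact add_tsub_cancel_right b M
    · intro b hb
      exact tsub_add_cancel_of_le (mem_filter.1 hb).2
  · rw [card_eq_zero, filter_eq_empty_iff]
    intro b hb hMb
    rw [mem_piAntidiag] at hb
    exact h (hb.1 ▸ sum_le_sum fun i _ => hMb i)

/-- The number of compositions with all parts raised by a fixed total area determines that area. -/
theorem le_of_shifted_card_eq {N E E' : ℕ}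
    (h : ∀ m, (if E ≤ m then #(piAntidiag (range N) (m - E)) else 0) =
      if E' ≤ m then #(piAntidiag (range N) (m - E')) else 0) : E' ≤ E := by
  by_contra hlt
  -- At `m = E` the left side counts just the zero tuple, while the right side vanishes.
  have := h E
  rw [if_pos le_rfl, if_neg hlt, Nat.sub_self, piAntidiag_zero, card_singleton] at this
  exact one_ne_zero this

/-! ### Profiles, envelopes and inclusion-exclusion -/

/-- The letters of a word diminished by one, extended by zero. -/
def profile (u : List ℕ+) (i : ℕ) : ℕ := (u.getD i 1).natPred

theorem profile_of_lt {u : List ℕ+} {i : ℕ} (h : i < u.length) : profile u i = u[i].natPred := by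
  rw [profile, List.getD_eq_getElem _ _ h]

theorem profile_of_le {u : List ℕ+} {i : ℕ} (h : u.length ≤ i) : profile u i = 0 := by
  rw [profile, List.getD_eq_default _ _ h]
  rfl

theorem lt_length_of_profile_ne_zero {u : List ℕ+} {i : ℕ} (h : profile u i ≠ 0) : i < u.length := by
  by_contra hi
  exact h (profile_of_le (by omega))

theorem profile_injOn_length {u v : List ℕ+} (hlen : u.length = v.length)
    (h : profile u = profile v) : u = v := by
  refine List.ext_getElem hlen fun i h₁ h₂ => ?_
  have := congrFun h i
  rw [profile_of_lt h₁, profile_of_lt h₂] at this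
  exact PNat.natPred_injective this

theorem sum_profile (w : List ℕ+) :
    ∑ j ∈ range w.length, profile w j + w.length = letterSum w := by
  induction w with
  | nil => simp [letterSum]
  | cons a w ih =>
    have h0 : profile (a :: w) 0 = a.natPred := rfl
    have hs : ∀ j, profile (a :: w) (j + 1) = profile w j := fun j => rfl
    have hsum : letterSum (a :: w) = a + letterSum w := by simp [letterSum]
    rw [List.length_cons, sum_range_succ', h0, hsum, ← ih, ← PNat.natPred_add_one a]
    simp only [hs]
    omega

/-- The length bound is essential: letters `1` have profile zero, so the inequalities alone do not
see them overrun `w`. -/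
theorem embeds_iff_profile {u w : List ℕ+} :
    Embeds u w ↔ ∃ s, s + u.length ≤ w.length ∧ ∀ i, profile u i ≤ profile w (s + i) := by
  constructor
  · rintro ⟨v, ⟨x, y, rfl⟩, huv⟩
    have hlen := huv.length_eq
    refine ⟨x.length, by simp; omega, fun i => ?_⟩
    by_cases hi : i < u.length
    · rw [profile_of_lt hi, profile_of_lt (by simp; omega)]
      rw [PNat.natPred_le_natPred]
      have := huv.get hi (by omega)
      simpa [List.getElem_append, hlen ▸ hi] using this
    · rw [profile_of_le (by omega)]
      exact Nat.zero_le _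
  · rintro ⟨s, hs, h⟩
    refine ⟨(w.drop s).take u.length,
      (List.take_prefix _ _).isInfix.trans (List.drop_suffix _ _).isInfix, ?_⟩
    rw [List.forall₂_iff_get]
    refine ⟨by simp; omega, fun i h₁ h₂ => ?_⟩
    have := h i
    rw [profile_of_lt h₁, profile_of_lt (by omega), PNat.natPred_le_natPred] at this
    simpa using this

theorem exists_profile_eq {N : ℕ} {b : ℕ → ℕ} (hb : ∀ j, b j ≠ 0 → j ∈ range N) :
    ∃ w : List ℕ+, w.length = N ∧ profile w = b := by
  refine ⟨(List.range N).map fun j => (b j).succPNat, by simp, funext fun j => ?_⟩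
  by_cases hj : j < N
  · rw [profile_of_lt (by simpa using hj)]
    simp
  · rw [profile_of_le (by simpa using hj)]
    by_contra h
    exact hj (mem_range.1 (hb j (Ne.symm h)))

/-- The least profile of a word into which `a` embeds at every position in `S`. -/
def envelope (a : ℕ → ℕ) (S : Finset ℕ) (j : ℕ) : ℕ :=
  S.sup fun s => if s ≤ j then a (j - s) else 0

theorem envelope_le_iff {a b : ℕ → ℕ} {S : Finset ℕ} :
    envelope a S ≤ b ↔ ∀ s ∈ S, ∀ i, a i ≤ b (s + i) := by
  constructor
  · intro h s hs i
    refine le_trans ?_ (h (s + i))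
    have := Finset.le_sup (f := fun s' => if s' ≤ s + i then a (s + i - s') else 0) hs
    simpa [envelope] using this
  · intro h j
    refine Finset.sup_le fun s hs => ?_
    split_ifs with hj
    · simpa [Nat.add_sub_cancel' hj] using h s hs (j - s)
    · exact Nat.zero_le _

theorem lt_envelope_iff {a : ℕ → ℕ} {S : Finset ℕ} {c j : ℕ} :
    c < envelope a S j ↔ ∃ s ∈ S, s ≤ j ∧ c < a (j - s) := by
  rw [envelope, Finset.lt_sup_iff]
  refine exists_congr fun s => and_congr_right fun _ => ?_
  split_ifs with h <;> simp [h]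

/-- The total excess over `1` of the least word into which `u` embeds at all positions in `S`. -/
def envelopeArea (u : List ℕ+) (N : ℕ) (S : Finset ℕ) : ℕ :=
  ∑ j ∈ range N, envelope (profile u) S j

theorem envelope_support {u : List ℕ+} {k : ℕ} {S : Finset ℕ} (hS : S ⊆ range (k + 1)) {j : ℕ}
    (hj : envelope (profile u) S j ≠ 0) : j ∈ range (u.length + k) := by
  obtain ⟨s, hs, hsj, h⟩ := lt_envelope_iff.1 (Nat.pos_of_ne_zero hj)
  have h1 := mem_range.1 (hS hs)
  have h2 := lt_length_of_profile_ne_zero h.ne'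
  exact mem_range.2 (by omega)

open scoped Classical in
theorem image_profile (u : List ℕ+) (k m : ℕ) :
    profile '' {w | w ∈ wordsAbove u ∧ w.length = u.length + k ∧
      letterSum w = m + (u.length + k)} =
    ((range (k + 1)).biUnion fun s =>
      {b ∈ piAntidiag (range (u.length + k)) m | envelope (profile u) {s} ≤ b} : Finset _) := by
  ext b
  simp only [Set.mem_image, Set.mem_ofPred_eq, coe_biUnion, Set.mem_iUnion, mem_coe,
    mem_filter, mem_piAntidiag, exists_prop, envelope_le_iff, mem_singleton, forall_eq]
  constructor
  · rintro ⟨w, ⟨hw, hlen, hsum⟩, rfl⟩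
    obtain ⟨s, hs, h⟩ := embeds_iff_profile.1 hw
    refine ⟨s, by rw [mem_range]; omega, ⟨?_, fun i hi => ?_⟩, h⟩
    · rw [← sum_profile, ← hlen] at hsum
      rw [← hlen]
      exact Nat.add_right_cancel hsum
    · rw [← hlen]
      exact mem_range.2 (lt_length_of_profile_ne_zero hi)
  · rintro ⟨s, hs, ⟨hsum, hsupp⟩, h⟩
    obtain ⟨w, hlen, rfl⟩ := exists_profile_eq hsupp
    rw [mem_range] at hs
    refine ⟨w, ⟨embeds_iff_profile.2 ⟨s, by omega, h⟩, hlen, ?_⟩, rfl⟩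
    rw [← sum_profile, hlen, hsum]

/-- Inclusion and exclusion over the positions at which `u` embeds. -/
theorem ncard_wordsAbove (u : List ℕ+) (k m : ℕ) :
    (({w | w ∈ wordsAbove u ∧ w.length = u.length + k ∧
      letterSum w = m + (u.length + k)} : Set (List ℕ+)).ncard : ℤ) =
    ∑ S ∈ (range (k + 1)).powerset with S.Nonempty, (-1) ^ (#S + 1) *
      ((if envelopeArea u (u.length + k) S ≤ m then
        #(piAntidiag (range (u.length + k)) (m - envelopeArea u (u.length + k) S)) else 0 : ℕ) : ℤ)
        := by
  classical
  have hinj : Set.InjOn profile {w | w ∈ wordsAbove u ∧ w.length = u.length + k ∧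
      letterSum w = m + (u.length + k)} :=
    fun w hw w' hw' h => profile_injOn_length (hw.2.1.trans hw'.2.1.symm) h
  rw [← hinj.ncard_image, image_profile, Set.ncard_coe_finset, inclusion_exclusion_card_biUnion]
  conv_rhs => rw [← Finset.sum_coe_sort]
  refine sum_congr rfl fun S _ => ?_
  obtain ⟨S, hS'⟩ := S
  obtain ⟨hS, hne⟩ := mem_filter.1 hS'
  rw [mem_powerset] at hS
  have heq : S.inf' hne (fun s =>
      {b ∈ piAntidiag (range (u.length + k)) m | envelope (profile u) {s} ≤ b}) =
      {b ∈ piAntidiag (range (u.length + k)) m | envelope (profile u) S ≤ b} := by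
    ext b
    simp only [mem_inf', mem_filter, envelope_le_iff, mem_singleton, forall_eq]
    obtain ⟨s, hs⟩ := hne
    exact ⟨fun h => ⟨(h s hs).1, fun s hs => (h s hs).2⟩, fun h s hs => ⟨h.1, h.2 s hs⟩⟩
  simp only [heq]
  rw [card_piAntidiag_ge fun j hj => envelope_support hS hj]
  rfl

/-! ### Level sets of unimodal words -/

/-- The number of letters of `u` exceeding `c + 1`. -/
def levelCount (u : List ℕ+) (c : ℕ) : ℕ := u.countP fun x => c < x.natPred

theorem levelCount_antitone (u : List ℕ+) : Antitone (levelCount u) := by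
  intro c d hcd
  refine List.countP_mono_left fun x _ h => ?_
  simp only [decide_eq_true_eq] at h ⊢
  omega

theorem card_lt_profile (u : List ℕ+) (c : ℕ) :
    #{i ∈ range u.length | c < profile u i} = levelCount u c := by
  induction u with
  | nil => simp [levelCount]
  | cons a u ih =>
    have h0 : profile (a :: u) 0 = a.natPred := rfl
    have hs : ∀ j, profile (a :: u) (j + 1) = profile u j := fun j => rfl
    rw [card_filter] at ih ⊢
    rw [List.length_cons, sum_range_succ', h0]
    simp only [hs]
    rw [ih, levelCount, levelCount, List.countP_cons]
    simp

theorem profile_le_letterSum (u : List ℕ+) (i : ℕ) : profile u i ≤ letterSum u := by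
  by_cases hi : i < u.length
  · have h1 := single_le_sum (f := profile u) (fun _ _ => Nat.zero_le _) (mem_range.2 hi)
    have h2 := sum_profile u
    omega
  · rw [profile_of_le (by omega)]
    exact Nat.zero_le _

/-- Position `j` dominates `i` if it lies in the increasing part, and `k` otherwise. -/
theorem HasIncDecFactorization.min_le_profile {u : List ℕ+} (hu : HasIncDecFactorization u)
    {i j k : ℕ} (hij : i ≤ j) (hjk : j ≤ k) : min (profile u i) (profile u k) ≤ profile u j := by
  obtain ⟨p, q, ⟨-, hp, -⟩, rfl, hq⟩ := hu
  by_cases hk : k < (p ++ q).length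
  swap
  · rw [profile_of_le (Nat.le_of_not_lt hk)]
    simp
  rw [profile_of_lt hk, profile_of_lt (hjk.trans_lt hk), profile_of_lt ((hij.trans hjk).trans_lt hk)]
  rcases hij.eq_or_lt with rfl | hij
  · exact min_le_left _ _
  rcases hjk.eq_or_lt with rfl | hjk
  · exact min_le_right _ _
  rw [List.length_append] at hk
  by_cases hj : j < p.length
  · refine (min_le_left _ _).trans (PNat.natPred_le_natPred.2 ?_)
    rw [List.getElem_append_left hj, List.getElem_append_left (hij.trans hj)]
    exact List.pairwise_iff_getElem.1 hp i j _ _ hij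
  · refine (min_le_right _ _).trans (PNat.natPred_le_natPred.2 ?_)
    rw [List.getElem_append_right (by omega), List.getElem_append_right (by omega)]
    exact List.pairwise_iff_getElem.1 hq _ _ (by omega) (by omega) (by omega)

/-- The level sets of a word with an increasing/decreasing factorization are intervals. -/
theorem HasIncDecFactorization.exists_level {u : List ℕ+} (hu : HasIncDecFactorization u) (c : ℕ) :
    ∃ α, ∀ i, c < profile u i ↔ α ≤ i ∧ i < α + levelCount u c := by
  set L : Finset ℕ := {i ∈ range u.length | c < profile u i} with hL
  have hmem : ∀ i, i ∈ L ↔ c < profile u i := by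
    intro i
    rw [hL, mem_filter, mem_range, and_iff_right_iff_imp]
    exact fun h => lt_length_of_profile_ne_zero (by omega)
  rcases L.eq_empty_or_nonempty with h | hne
  · refine ⟨0, fun i => ?_⟩
    rw [← card_lt_profile, ← hL, ← hmem, h]
    simp
  · have hIcc : L = Icc (L.min' hne) (L.max' hne) := by
      refine Finset.Subset.antisymm (fun i hi => mem_Icc.2 ⟨L.min'_le i hi, L.le_max' i hi⟩) ?_
      intro i hi
      rw [mem_Icc] at hi
      rw [hmem]
      exact (lt_min ((hmem _).1 (L.min'_mem hne)) ((hmem _).1 (L.max'_mem hne))).trans_le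
        (hu.min_le_profile hi.1 hi.2)
    have hle := L.min'_le _ (L.max'_mem hne)
    refine ⟨L.min' hne, fun i => ?_⟩
    have hcard : levelCount u c = L.max' hne + 1 - L.min' hne := by
      rw [← card_lt_profile, ← hL, ← Nat.card_Icc, ← hIcc]
    rw [hcard, ← hmem]
    constructor
    · intro hi
      have := L.min'_le i hi
      have := L.le_max' i hi
      omega
    · intro hi
      rw [hIcc, mem_Icc]
      omega

theorem HasIncDecFactorization.envelopeArea_eq {u : List ℕ+} (hu : HasIncDecFactorization u)
    {k B : ℕ} (hB : ∀ i, profile u i ≤ B) {S : Finset ℕ} (hS : S ⊆ range (k + 1)) :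
    envelopeArea u (u.length + k) S = ∑ c ∈ range B, coverCard S (levelCount u c) := by
  have hle : ∀ j ∈ range (u.length + k), envelope (profile u) S j ≤ B := by
    intro j _
    refine Finset.sup_le fun s _ => ?_
    split_ifs
    · exact hB _
    · exact Nat.zero_le _
  rw [envelopeArea, sum_eq_sum_card_lt _ hle]
  refine sum_congr rfl fun c _ => ?_
  obtain ⟨α, hα⟩ := hu.exists_level c
  -- The level interval starts at `α`, whereas `coverCard` uses intervals starting at `s`; shifting
  -- by `α` aligns them.
  rw [coverCard, ← card_map (s := S.biUnion _) (addRightEmbedding α)]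
  congr 1
  ext j
  simp only [mem_filter, mem_map, mem_biUnion, mem_Ico, addRightEmbedding_apply]
  rw [and_iff_right_of_imp fun h => envelope_support hS (by omega), lt_envelope_iff]
  constructor
  · rintro ⟨s, hs, hsj, h⟩
    rw [hα] at h
    exact ⟨j - α, ⟨s, hs, by omega⟩, by omega⟩
  · rintro ⟨x, ⟨s, hs, h⟩, rfl⟩
    refine ⟨s, hs, by omega, ?_⟩
    rw [hα]
    omega

/-! ### The two implications -/

theorem length_le_of_embeds {u w : List ℕ+} (h : Embeds u w) : u.length ≤ w.length := by
  obtain ⟨s, hs, -⟩ := embeds_iff_profile.1 h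
  omega

theorem length_le_letterSum (w : List ℕ+) : w.length ≤ letterSum w := by
  have := sum_profile w
  omega

theorem WilfEquiv.ncard_eq {u v : List ℕ+} (h : WilfEquiv u v) (n m : ℕ) :
    ({w | w ∈ wordsAbove u ∧ w.length = n ∧ letterSum w = m} : Set (List ℕ+)).ncard =
      ({w | w ∈ wordsAbove v ∧ w.length = n ∧ letterSum w = m} : Set (List ℕ+)).ncard := by
  have := congrFun h (Finsupp.single 0 n + Finsupp.single 1 m)
  simpa [genF] using this

/-- The word `u` embeds itself, so some word of length `|u|` must embed `v`. -/
theorem WilfEquiv.length_le {u v : List ℕ+} (h : WilfEquiv u v) : v.length ≤ u.length := by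
  have hfin : {w | w ∈ wordsAbove u ∧ w.length = u.length ∧ letterSum w = letterSum u}.Finite :=
    (finite_words _ _).subset fun w hw => hw.2
  have hu : u ∈ {w | w ∈ wordsAbove u ∧ w.length = u.length ∧ letterSum w = letterSum u} :=
    ⟨embeds_iff_profile.2 ⟨0, by simp⟩, rfl, rfl⟩
  have hpos := (Set.ncard_pos hfin).2 ⟨u, hu⟩
  rw [h.ncard_eq] at hpos
  obtain ⟨w, hw, hlen, -⟩ := Set.nonempty_of_ncard_ne_zero hpos.ne'
  exact hlen ▸ length_le_of_embeds hw

theorem wilfEquiv_of_perm {u v : List ℕ+} (hu : HasIncDecFactorization u)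
    (hv : HasIncDecFactorization v) (h : u.Perm v) : WilfEquiv u v := by
  have hlen := h.length_eq
  funext d
  have hempty : ∀ u : List ℕ+, d 0 < u.length ∨ d 1 < d 0 →
      {w | w ∈ wordsAbove u ∧ w.length = d 0 ∧ letterSum w = d 1} = ∅ := by
    intro u hd
    rw [Set.eq_empty_iff_forall_notMem]
    rintro w ⟨hw, h0, h1⟩
    have := length_le_of_embeds hw
    have := length_le_letterSum w
    omega
  simp only [genF]
  by_cases hd : d 0 < u.length ∨ d 1 < d 0
  · rw [hempty u hd, hempty v (hlen ▸ hd)]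
  · push Not at hd
    obtain ⟨k, hk⟩ := Nat.exists_eq_add_of_le hd.1
    obtain ⟨m, hm⟩ := Nat.exists_eq_add_of_le' (hk ▸ hd.2)
    rw [hk, hm, ncard_wordsAbove u]
    rw [hlen, ncard_wordsAbove v]
    refine sum_congr rfl fun S hS => ?_
    have hS' := mem_powerset.1 (mem_filter.1 hS).1
    have harea : envelopeArea u (v.length + k) S = envelopeArea v (v.length + k) S := by
      rw [← hlen, hu.envelopeArea_eq (B := letterSum u + letterSum v)
        (fun i => (profile_le_letterSum u i).trans (Nat.le_add_right _ _)) hS', hlen,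
        hv.envelopeArea_eq (B := letterSum u + letterSum v)
        (fun i => (profile_le_letterSum v i).trans (Nat.le_add_left _ _)) hS']
      refine sum_congr rfl fun c _ => ?_
      rw [levelCount, h.countP_eq, levelCount]
    rw [harea]

theorem WilfEquiv.sum_coverCard_pair {u v : List ℕ+} (hu : HasIncDecFactorization u)
    (hv : HasIncDecFactorization v) (h : WilfEquiv u v) {B : ℕ} (hBu : ∀ i, profile u i ≤ B)
    (hBv : ∀ i, profile v i ≤ B) (k : ℕ) :
    ∑ c ∈ range B, coverCard {0, k} (levelCount u c) =
      ∑ c ∈ range B, coverCard {0, k} (levelCount v c) := by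
  induction k using Nat.strong_induction_on with
  | _ k ih =>
    have hlen : u.length = v.length :=
      le_antisymm (WilfEquiv.length_le (Eq.symm h)) (WilfEquiv.length_le h)
    have hpair : ({0, k} : Finset ℕ) ⊆ range (k + 1) := by
      simp [insert_subset_iff]
    have hmem : ({0, k} : Finset ℕ) ∈
        ({S ∈ (range (k + 1)).powerset | S.Nonempty} : Finset _) :=
      mem_filter.2 ⟨mem_powerset.2 hpair, insert_nonempty _ _⟩
    have key : ∀ m,
        (if envelopeArea u (v.length + k) {0, k} ≤ m then
          #(piAntidiag (range (v.length + k)) (m - envelopeArea u (v.length + k) {0, k})) else 0) =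
        if envelopeArea v (v.length + k) {0, k} ≤ m then
          #(piAntidiag (range (v.length + k)) (m - envelopeArea v (v.length + k) {0, k})) else 0 := by
      intro m
      have h1 := ncard_wordsAbove u k m
      rw [h.ncard_eq, hlen, ncard_wordsAbove v k m, ← add_sum_erase _ _ hmem,
        ← add_sum_erase _ _ hmem] at h1
      -- The induction hypothesis equates all terms other than that of `{0, k}`, which is thereby
      -- isolated.
      rw [sum_congr rfl (s₁ := erase _ _) fun S hS => ?_, add_left_inj] at h1
      · exact_mod_cast (mul_left_cancel₀ (pow_ne_zero _ (by norm_num)) h1).symm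
      · obtain ⟨hne, hS⟩ := mem_erase.1 hS
        obtain ⟨hS, hS'⟩ := mem_filter.1 hS
        rw [mem_powerset] at hS
        have := sum_coverCard_congr ih hS' hS hne
        rw [← hu.envelopeArea_eq hBu hS, ← hv.envelopeArea_eq hBv hS, hlen] at this
        rw [this]
    have harea := le_antisymm (le_of_shifted_card_eq fun m => (key m).symm)
      (le_of_shifted_card_eq key)
    rwa [← hu.envelopeArea_eq hBu hpair, ← hv.envelopeArea_eq hBv hpair, hlen]

theorem WilfEquiv.perm {u v : List ℕ+} (hu : HasIncDecFactorization u)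
    (hv : HasIncDecFactorization v) (h : WilfEquiv u v) : u.Perm v := by
  have hlen : u.length = v.length :=
    le_antisymm (WilfEquiv.length_le (Eq.symm h)) (WilfEquiv.length_le h)
  have hlevel : ∀ c, levelCount u c = levelCount v c := by
    intro c
    -- The bound must dominate both profiles and exceed `c`, so that level `c` is among those
    -- summed.
    have hBu : ∀ i, profile u i ≤ letterSum u + letterSum v + (c + 1) := fun i => by
      have := profile_le_letterSum u i
      omega
    have hBv : ∀ i, profile v i ≤ letterSum u + letterSum v + (c + 1) := fun i => by
      have := profile_le_letterSum v i
      omega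
    have hpair := fun k => h.sum_coverCard_pair hu hv hBu hBv k
    simp only [coverCard_pair, sum_add_distrib] at hpair
    -- The pair `{0, 0}` gives the total mass, to be subtracted from the other sums.
    have h0 := hpair 0
    simp only [Nat.zero_min, sum_const_zero, add_zero] at h0
    refine eq_of_sum_min_eq (levelCount_antitone u) (levelCount_antitone v) (fun d => ?_)
      (B := letterSum u + letterSum v + (c + 1)) (by omega)
    have := hpair d
    omega
  -- Letter multiplicities are differences of consecutive level counts, starting from the length.
  have hcount_zero : ∀ w : List ℕ+, w.count 1 + levelCount w 0 = w.length := by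
    intro w
    induction w with
    | nil => rfl
    | cons a w ih =>
      have ha := PNat.natPred_add_one a
      rw [List.length_cons, ← ih, levelCount, levelCount, List.countP_cons, List.count_cons]
      have : a = 1 ↔ ¬ 0 < a.natPred := by rw [← PNat.coe_eq_one_iff]; omega
      by_cases h : 0 < a.natPred <;> simp [this, h] <;> omega
  have hcount_succ : ∀ (c : ℕ) (w : List ℕ+),
      w.count (c + 1).succPNat + levelCount w (c + 1) = levelCount w c := by
    intro c w
    induction w with
    | nil => rfl
    | cons a w ih =>
      have hc : a = (c + 1).succPNat ↔ a.natPred = c + 1 := by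
        rw [← PNat.natPred_inj, Nat.natPred_succPNat]
      rw [levelCount, levelCount] at ih ⊢
      rw [List.countP_cons, List.countP_cons, List.count_cons, ← ih]
      simp only [beq_iff_eq, decide_eq_true_eq, hc]
      split_ifs <;> omega
  rw [List.perm_iff_count]
  intro a
  rw [← PNat.succPNat_natPred a]
  cases a.natPred with
  | zero =>
    have h1 := hcount_zero u
    have h2 := hcount_zero v
    rw [hlevel] at h1
    change u.count 1 = v.count 1
    omega
  | succ c =>
    have h1 := hcount_succ c u
    have h2 := hcount_succ c v
    rw [hlevel, hlevel] at h1
    omega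

end FactorOrder

theorem theorem2 (u v : List ℕ+)
    (hu : FactorOrder.HasIncDecFactorization u) (hv : FactorOrder.HasIncDecFactorization v) :
    FactorOrder.WilfEquiv u v ↔ u.Perm v :=
  ⟨fun h => h.perm hu hv, FactorOrder.wilfEquiv_of_perm hu hv⟩
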